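/- An *operator system* is a norm closed, self-adjoint complex linear subspace $A$ of a unital $C^*$-algebra $B$ containing the unit $1$ of $B$. Its *state space* $\mathcal S(A)$ is the set of positive linear functionals $\varphi$ on $A$ with $\varphi(1)=1$, with the weak* topology; for $a\in A$ let $\hat a:\mathcal S(A)\to\mathbb C$ be the affine function $\hat a(\varphi)=\varphi(a)$. A *metric set* of $A$ is a nonempty subset $K\subseteq A$ that is norm compact, self-adjoint ($a\in K\Rightarrow a^*\in K$), balanced ($zK\subseteq K$ for all $z\in\mathbb C$ with $|z|\le 1$) and convex, and that separates the states on $A$ (two states that agree on $K$ are equal). Let $A$ be an operator system and $K$ a metric set of $A$. For every subset $S\subseteq A$ the following conditions are equivalent: 1. $S$ is norm relatively compact. 2. The set of affine functions $\{\hat a : a\in S\}$ is uniformly bounded on $\mathcal S(A)$ and equicontinuous with respect to the weak* topology on $\mathcal S(A)$. 3. $S$ is norm bounded and for every $\varepsilon>0$ there exists $\lambda>0$ such that $$S\subseteq A_\varepsilon+\lambda K+\mathbb C1,\qquad A_\varepsilon=\{a\in A:\|a\|\le\varepsilon\}.$$ -/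

import Mathlib

open scoped Pointwise ComplexOrder

/-- A (concrete) operator system: a norm closed, self-adjoint complex linear subspace of a unital
C⋆-algebra `B` which contains the unit of `B`.  It carries the norm of `B`. -/
structure OperatorSystem (B : Type*) [CStarAlgebra B] extends Submodule ℂ B where
  one_mem' : (1 : B) ∈ carrier
  star_mem' : ∀ {a : B}, a ∈ carrier → star a ∈ carrier
  isClosed' : IsClosed carrier

namespace OperatorSystem

variable {B : Type*} [CStarAlgebra B]

/-- The unit of the operator system. -/
instance (A : OperatorSystem B) : One A.toSubmodule := ⟨⟨1, A.one_mem'⟩⟩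

/-- The involution of the operator system. -/
instance (A : OperatorSystem B) : Star A.toSubmodule :=
  ⟨fun a => ⟨star (a : B), A.star_mem' a.2⟩⟩

/-- The state space of `A`: the unital positive linear functionals on `A`, where `a : A` is
positive when it is positive in the ambient C⋆-algebra.  (A positive linear functional on an
operator system is automatically continuous, so that asking for continuity is no restriction.)
As a subtype of the weak dual it carries the weak⋆-topology of pointwise convergence on `A`. -/
def stateSpace [PartialOrder B] [StarOrderedRing B] (A : OperatorSystem B) :
    Set (WeakDual ℂ A.toSubmodule) :=
  {φ | φ 1 = 1 ∧ ∀ a : A.toSubmodule, 0 ≤ (a : B) → 0 ≤ φ a}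

/-- The affine function `â : φ ↦ φ a` on the state space. -/
noncomputable def hat [PartialOrder B] [StarOrderedRing B] (A : OperatorSystem B) (a : A.toSubmodule) :
    A.stateSpace → ℂ :=
  fun φ => (φ : WeakDual ℂ A.toSubmodule) a

/-- Metric sets of an operator system: (nonempty) norm compact, self-adjoint, balanced, convex
sets which separate the states. -/
structure IsMetricSet [PartialOrder B] [StarOrderedRing B] (A : OperatorSystem B)
    (K : Set A.toSubmodule) : Prop where
  nonempty : K.Nonempty
  isCompact : IsCompact K
  star_mem : ∀ a ∈ K, star a ∈ K
  balanced : Balanced ℂ K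
  convex : Convex ℝ K
  separates : ∀ φ ∈ A.stateSpace, ∀ ψ ∈ A.stateSpace, (∀ a ∈ K, φ a = ψ a) → φ = ψ

end OperatorSystem

/-! ### Positive functionals on a unital C⋆-algebra. -/

section CStarAlgebra

open scoped ComplexStarModule

variable {B : Type*} [CStarAlgebra B] [PartialOrder B] [StarOrderedRing B]

/-! Since `A` is complete, relative compactness is total boundedness. States recover the norm up to
a factor 2, so `a ↦ â` is a uniform embedding into the continuous functions on the compact state
space, and 1 ⇔ 2 is Arzelà–Ascoli. For 3 ⇒ 1, boundedness of `S` confines the scalars to a disc, so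
`S` lies within `ε` of a compact set. For 1 ⇒ 3, the span of `K` and `1` is dense and its elements
have the form `s • k + z • 1`; a finite net of `S` then needs only one dilation factor. Density is
dual to: a functional `g` killing `K` and `1` is zero. By Jordan decomposition, `Re g` on
self-adjoint elements is a difference of positive functionals, of equal mass as `g 1 = 0`.
Normalized, they are states agreeing on `K`, hence equal. The same applies to `-I • g`. -/

theorem IsSelfAdjoint.norm_le_of_neg_le_of_le [Nontrivial B] {a : B} (ha : IsSelfAdjoint a)
    {r : ℝ} (h₁ : -algebraMap ℝ B r ≤ a) (h₂ : a ≤ algebraMap ℝ B r) : ‖a‖ ≤ r := by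
  rw [← map_neg, algebraMap_le_iff_le_spectrum] at h₁
  rw [le_algebraMap_iff_spectrum_le] at h₂
  rcases CStarAlgebra.norm_or_neg_norm_mem_spectrum ha with h | h
  · exact h₂ _ h
  · linarith [h₁ _ h]

/-- **Jordan decomposition**: a contractive real functional on the self-adjoint part of a unital
C⋆-algebra is a difference of two positive functionals of total mass one. -/
theorem exists_positive_sub_positive [Nontrivial B] (f : selfAdjoint B →ₗ[ℝ] ℝ)
    (hf : ∀ a, |f a| ≤ ‖(a : B)‖) :
    ∃ φ ψ : selfAdjoint B →ₗ[ℝ] ℝ, (∀ a : selfAdjoint B, 0 ≤ (a : B) → 0 ≤ φ a) ∧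
      (∀ a : selfAdjoint B, 0 ≤ (a : B) → 0 ≤ ψ a) ∧ φ 1 + ψ 1 = 1 ∧ ∀ a, f a = φ a - ψ a := by
  -- The pair `(φ, ψ)` is sought as one positive functional `g (x, y) = φ x + ψ y`, prescribed where
  -- `x + y` is scalar. There `τ` only serves to read off that scalar.
  obtain ⟨τ₀, -, hτ₀⟩ := exists_dual_vector ℝ (1 : B) (by simp)
  let τ : selfAdjoint B →ₗ[ℝ] ℝ := τ₀.toLinearMap ∘ₗ (selfAdjoint.submodule ℝ B).subtype
  have hτ : τ 1 = 1 := by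
    change τ₀ (1 : B) = 1
    simp [hτ₀]
  let p : Submodule ℝ (selfAdjoint B × selfAdjoint B) :=
    (Submodule.span ℝ {(1 : selfAdjoint B)}).comap
      (LinearMap.fst ℝ _ _ + LinearMap.snd ℝ _ _)
  have hp : ∀ z, z ∈ p ↔ ∃ s : ℝ, s • (1 : selfAdjoint B) = z.1 + z.2 := fun z => by
    simp [p, Submodule.mem_span_singleton]
  let F : selfAdjoint B × selfAdjoint B →ₗ[ℝ] ℝ :=
    (2 : ℝ)⁻¹ • (f ∘ₗ (LinearMap.fst ℝ _ _ - LinearMap.snd ℝ _ _) +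
      τ ∘ₗ (LinearMap.fst ℝ _ _ + LinearMap.snd ℝ _ _))
  have hF : ∀ z, F z = 2⁻¹ * (f (z.1 - z.2) + τ (z.1 + z.2)) := fun z => by
    simp [F]
    ring
  let C : PointedCone ℝ (selfAdjoint B × selfAdjoint B) :=
    { carrier := {z | 0 ≤ (z.1 : B) ∧ 0 ≤ (z.2 : B)}
      add_mem' := fun {a b} ha hb => by
        exact ⟨by simpa using add_nonneg ha.1 hb.1, by simpa using add_nonneg ha.2 hb.2⟩
      zero_mem' := by simp
      smul_mem' := fun c a ha => by
        refine ⟨?_, ?_⟩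
        · simpa using! smul_nonneg c.2 ha.1
        · simpa using! smul_nonneg c.2 ha.2 }
  have hC : ∀ z, z ∈ C ↔ 0 ≤ (z.1 : B) ∧ 0 ≤ (z.2 : B) := fun z => Iff.rfl
  have hle : ∀ (a : selfAdjoint B), (a : B) ≤ ‖(a : B)‖ • (1 : B) := fun a => by
    rw [← Algebra.algebraMap_eq_smul_one]
    exact IsSelfAdjoint.le_algebraMap_norm_self a.2
  obtain ⟨g, hg, hgC⟩ := riesz_extension C ⟨p, F.domRestrict p⟩ (by
    rintro ⟨⟨x, y⟩, hxy⟩ hxyC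
    obtain ⟨s, hs⟩ := (hp _).1 hxy
    obtain ⟨hx, hy⟩ := (hC _).1 hxyC
    simp only at hs hx hy
    have hs' : (x : B) + y = algebraMap ℝ B s := by
      rw [Algebra.algebraMap_eq_smul_one]
      simpa using congrArg (Subtype.val) hs.symm
    -- Positivity on the subspace: `x, y ≥ 0` and `x + y = s` force `-s ≤ x - y ≤ s`.
    have hn : ‖((x - y : selfAdjoint B) : B)‖ ≤ s := by
      refine IsSelfAdjoint.norm_le_of_neg_le_of_le (x - y).2 ?_ ?_
      · rw [← hs', AddSubgroupClass.coe_sub, ← sub_nonneg]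
        have : (x : B) - y - -(x + y) = x + x := by abel
        rw [this]
        exact add_nonneg hx hx
      · rw [← hs', AddSubgroupClass.coe_sub, ← sub_nonneg]
        have : (x : B) + y - (x - y) = y + y := by abel
        rw [this]
        exact add_nonneg hy hy
    change 0 ≤ F (x, y)
    rw [hF, ← hs, map_smul, hτ]
    have := (abs_le.1 ((hf (x - y)).trans hn)).1
    simp only [smul_eq_mul, mul_one]
    linarith) (by
    rintro ⟨x, y⟩
    let t : ℝ := ‖(x : B)‖ + ‖(y : B)‖
    refine ⟨⟨(t • 1, t • 1), (hp _).2 ⟨t + t, by simp [add_smul]⟩⟩, ?_⟩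
    have key : ∀ a : selfAdjoint B, ‖(a : B)‖ ≤ t → 0 ≤ ((t • 1 + a : selfAdjoint B) : B) := by
      intro a ha
      have h := hle (-a)
      have h2 : ‖(a : B)‖ • (1 : B) ≤ t • (1 : B) := smul_le_smul_of_nonneg_right ha zero_le_one
      simp only [NegMemClass.coe_neg, norm_neg] at h
      have := h.trans h2
      rw [neg_le_iff_add_nonneg] at this
      simpa using this
    refine (hC _).2 ⟨key x ?_, key y ?_⟩
    · simp [t]
    · simp [t])
  have hg' : ∀ z ∈ p, g z = F z := fun z hz => hg ⟨z, hz⟩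
  refine ⟨g ∘ₗ LinearMap.inl ℝ _ _, g ∘ₗ LinearMap.inr ℝ _ _, fun a ha => hgC _ ?_,
    fun a ha => hgC _ ?_, ?_, fun a => ?_⟩
  · exact (hC _).2 ⟨ha, by simp⟩
  · exact (hC _).2 ⟨by simp, ha⟩
  -- `(1, 1)` gives the total mass; below, `(a, -a)` gives `f a`.
  · have h := hg' (1, 1) ((hp _).2 ⟨2, by rw [two_smul]⟩)
    rw [hF] at h
    simp only [LinearMap.comp_apply, ← map_add]
    simp [h, hτ]
    norm_num
  · have h := hg' (a, -a) ((hp _).2 ⟨0, by simp⟩)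
    rw [hF] at h
    simp only [LinearMap.comp_apply, ← map_sub]
    simp [h]
    ring

/-- A positive real functional on the self-adjoint part of a unital C⋆-algebra extends to a
continuous complex linear functional. -/
theorem exists_complexification (φ : selfAdjoint B →ₗ[ℝ] ℝ)
    (hφ : ∀ a : selfAdjoint B, 0 ≤ (a : B) → 0 ≤ φ a) :
    ∃ Φ : StrongDual ℂ B, ∀ b, Φ b = φ (ℜ b) + Complex.I * φ (ℑ b) := by
  have hbound : ∀ a : selfAdjoint B, |φ a| ≤ φ 1 * ‖(a : B)‖ := by
    intro a
    have h₁ := hφ (‖(a : B)‖ • 1 - a) (by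
      have := IsSelfAdjoint.le_algebraMap_norm_self a.2
      rw [Algebra.algebraMap_eq_smul_one, ← sub_nonneg] at this
      simpa using this)
    have h₂ := hφ (‖(a : B)‖ • 1 + a) (by
      have := IsSelfAdjoint.neg_algebraMap_norm_le_self a.2
      rw [Algebra.algebraMap_eq_smul_one, neg_le_iff_add_nonneg'] at this
      simpa using this)
    simp only [map_sub, map_add, map_smul, smul_eq_mul] at h₁ h₂
    rw [abs_le]
    constructor <;> linarith
  let Φ : B →ₗ[ℂ] ℂ := Module.Dual.extendRCLike (𝕜 := ℂ) (φ ∘ₗ realPart)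
  have hΦ : ∀ b, Φ b = φ (ℜ b) + Complex.I * φ (ℑ b) := fun b => by
    simp [Φ, Module.Dual.extendRCLike_apply, realPart_I_smul]
  have h1 : 0 ≤ φ 1 := hφ 1 (by simp)
  refine ⟨Φ.mkContinuous (φ 1 + φ 1) fun b => ?_, hΦ⟩
  rw [hΦ, add_mul]
  refine (norm_add_le _ _).trans (add_le_add ?_ ?_)
  · rw [Complex.norm_real]
    exact (hbound _).trans (by gcongr; exact realPart.norm_le b)
  · rw [norm_mul, Complex.norm_I, one_mul, Complex.norm_real]
    exact (hbound _).trans (by gcongr; exact imaginaryPart.norm_le b)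

end CStarAlgebra

namespace OperatorSystem

open scoped ComplexStarModule
open Complex (I)

/-! ### Positive functionals and states of an operator system. -/

section PositiveFunctionals

variable {B : Type*} [CStarAlgebra B] {A : OperatorSystem B}

@[simp]
theorem coe_one : ((1 : A.toSubmodule) : B) = 1 := rfl

@[simp]
theorem coe_star (a : A.toSubmodule) : ((star a : A.toSubmodule) : B) = star (a : B) := rfl

theorem exists_coe_eq_realPart (a : A.toSubmodule) :
    ∃ h : A.toSubmodule, (h : B) = ℜ (a : B) ∧ h = (2 : ℂ)⁻¹ • (a + star a) := by
  refine ⟨(2 : ℂ)⁻¹ • (a + star a), ?_, rfl⟩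
  rw [realPart_apply_coe, ← Complex.coe_smul]
  simp

theorem exists_coe_eq_imaginaryPart (a : A.toSubmodule) :
    ∃ k : A.toSubmodule, (k : B) = ℑ (a : B) ∧ k = -I • (2 : ℂ)⁻¹ • (a - star a) := by
  refine ⟨-I • (2 : ℂ)⁻¹ • (a - star a), ?_, rfl⟩
  rw [imaginaryPart_apply_coe, ← Complex.coe_smul]
  simp

theorem isCompact_closure_iff_totallyBounded {S : Set A.toSubmodule} :
    IsCompact (closure S) ↔ TotallyBounded S := by
  have : CompleteSpace A.toSubmodule := A.isClosed'.completeSpace_coe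
  exact ⟨fun h => h.totallyBounded.subset subset_closure,
    fun h => h.closure.isCompact_of_isClosed isClosed_closure⟩

variable [PartialOrder B] [StarOrderedRing B]

theorem nonneg_norm_smul_one_sub (a : A.toSubmodule) (ha : IsSelfAdjoint (a : B)) :
    0 ≤ (((‖a‖ : ℂ) • 1 - a : A.toSubmodule) : B) := by
  have := ha.le_algebraMap_norm_self
  rw [Algebra.algebraMap_eq_smul_one, ← sub_nonneg, ← Complex.coe_smul] at this
  simpa using this

/-- A positive functional on an operator system takes real values on self-adjoint elements, and
attains its norm over them at the unit. -/
theorem exists_real_of_positive {φ : WeakDual ℂ A.toSubmodule}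
    (hφ : ∀ a : A.toSubmodule, 0 ≤ (a : B) → 0 ≤ φ a) {c : ℝ} (hc : φ 1 = c)
    {a : A.toSubmodule} (ha : IsSelfAdjoint (a : B)) : ∃ r : ℝ, φ a = r ∧ |r| ≤ c * ‖a‖ := by
  have h₁ := hφ _ (nonneg_norm_smul_one_sub a ha)
  have h₂ := hφ _ (nonneg_norm_smul_one_sub (-a) (by simpa using ha.neg))
  rw [map_sub, map_smul, hc, Complex.le_def] at h₁ h₂
  simp at h₁ h₂
  refine ⟨(φ a).re, Complex.ext rfl (by simpa using h₁.2), ?_⟩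
  rw [abs_le, Submodule.coe_norm, mul_comm]
  constructor <;> linarith [h₁.1, h₂.1]

theorem norm_apply_le_of_positive {φ : WeakDual ℂ A.toSubmodule}
    (hφ : ∀ a : A.toSubmodule, 0 ≤ (a : B) → 0 ≤ φ a) {c : ℝ} (hc : φ 1 = c)
    (a : A.toSubmodule) : ‖φ a‖ ≤ 2 * c * ‖a‖ := by
  obtain ⟨h, hh, -⟩ := exists_coe_eq_realPart a
  obtain ⟨k, hk, -⟩ := exists_coe_eq_imaginaryPart a
  have hc0 : 0 ≤ c := by
    have := hφ 1 (by simp)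
    rw [hc] at this
    exact_mod_cast this
  have ha : a = h + I • k := Subtype.ext (by
    simp [hh, hk, realPart_add_I_smul_imaginaryPart])
  obtain ⟨r, hr, hr'⟩ := exists_real_of_positive hφ hc (a := h) (hh ▸ (ℜ (a : B)).2)
  obtain ⟨s, hs, hs'⟩ := exists_real_of_positive hφ hc (a := k) (hk ▸ (ℑ (a : B)).2)
  have hhn : ‖h‖ ≤ ‖a‖ := by
    rw [Submodule.coe_norm, hh]
    exact realPart.norm_le (a : B)
  have hkn : ‖k‖ ≤ ‖a‖ := by
    rw [Submodule.coe_norm, hk]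
    exact imaginaryPart.norm_le (a : B)
  calc ‖φ a‖ = ‖(r : ℂ) + I * s‖ := by rw [ha, map_add, map_smul, hr, hs, smul_eq_mul]
    _ ≤ |r| + |s| := by
      refine (norm_add_le _ _).trans ?_
      simp
    _ ≤ c * ‖a‖ + c * ‖a‖ := add_le_add (hr'.trans (by gcongr)) (hs'.trans (by gcongr))
    _ = 2 * c * ‖a‖ := by ring

theorem norm_apply_le_of_mem_stateSpace {φ : WeakDual ℂ A.toSubmodule} (hφ : φ ∈ A.stateSpace)
    (a : A.toSubmodule) : ‖φ a‖ ≤ 2 * ‖a‖ := by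
  simpa using norm_apply_le_of_positive hφ.2 (c := 1) (by simpa using hφ.1) a

/-- A positive functional is zero or a positive multiple of a state. -/
theorem eq_zero_or_exists_smul_state {φ : WeakDual ℂ A.toSubmodule}
    (hφ : ∀ a : A.toSubmodule, 0 ≤ (a : B) → 0 ≤ φ a) {c : ℝ} (hc : φ 1 = c) :
    (∀ a, φ a = 0) ∨ 0 < c ∧ ((c : ℂ)⁻¹ • φ) ∈ A.stateSpace := by
  have hc0 : 0 ≤ c := by
    have := hφ 1 (by simp)
    rw [hc] at this
    exact_mod_cast this
  rcases hc0.eq_or_lt with rfl | h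
  · left
    intro a
    simpa using norm_apply_le_of_positive hφ hc a
  · refine Or.inr ⟨h, ?_, fun a ha => ?_⟩
    · change (c : ℂ)⁻¹ * φ 1 = 1
      rw [hc, inv_mul_cancel₀ (by exact_mod_cast h.ne')]
    · change 0 ≤ (c : ℂ)⁻¹ * φ a
      refine mul_nonneg ?_ (hφ a ha)
      rw [← Complex.ofReal_inv]
      exact_mod_cast (inv_pos.2 h).le

theorem isCompact_stateSpace : IsCompact A.stateSpace := by
  refine (WeakDual.isCompact_closedBall (𝕜 := ℂ) (0 : StrongDual ℂ A.toSubmodule)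
    2).of_isClosed_subset ?_ ?_
  · have : A.stateSpace = {φ | φ 1 = 1} ∩
        ⋂ a : A.toSubmodule, ⋂ _ : 0 ≤ (a : B), {φ | 0 ≤ φ a} := by
      ext φ
      simp [stateSpace]
    rw [this]
    refine (isClosed_eq (WeakDual.eval_continuous 1) continuous_const).inter
      (isClosed_iInter fun a => isClosed_iInter fun _ => ?_)
    exact isClosed_le continuous_const (WeakDual.eval_continuous a)
  · intro φ hφ
    simp only [Set.mem_preimage, mem_closedBall_zero_iff]
    exact ContinuousLinearMap.opNorm_le_bound _ zero_le_two
      fun a => norm_apply_le_of_mem_stateSpace hφ a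

/-- The Jordan decomposition for functionals on an operator system. -/
theorem exists_positive_sub_positive [Nontrivial B] (g : StrongDual ℂ A.toSubmodule)
    (hg : ∀ a, ‖g a‖ ≤ ‖a‖) :
    ∃ (φ ψ : WeakDual ℂ A.toSubmodule) (c d : ℝ),
      (∀ a : A.toSubmodule, 0 ≤ (a : B) → 0 ≤ φ a) ∧
      (∀ a : A.toSubmodule, 0 ≤ (a : B) → 0 ≤ ψ a) ∧ φ 1 = c ∧ ψ 1 = d ∧ c + d = 1 ∧
      ∀ a h k : A.toSubmodule, (h : B) = ℜ (a : B) → (k : B) = ℑ (a : B) →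
        φ a - ψ a = (g h).re + I * (g k).re := by
  -- Only the real part of `g` on self-adjoint elements is decomposed, so `φ - ψ` is its
  -- complexification and need not equal `g`.
  obtain ⟨G, hG, hGn⟩ := exists_extension_norm_eq A.toSubmodule g
  let f : selfAdjoint B →ₗ[ℝ] ℝ :=
    Complex.reLm ∘ₗ (G.toLinearMap.restrictScalars ℝ) ∘ₗ (selfAdjoint.submodule ℝ B).subtype
  have hf : ∀ a, f a = (G a).re := fun a => rfl
  obtain ⟨φ, ψ, hφ, hψ, h1, hfφ⟩ := _root_.exists_positive_sub_positive f fun a => by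
    rw [hf]
    refine (Complex.abs_re_le_norm _).trans ((G.le_opNorm _).trans ?_)
    rw [hGn]
    exact mul_le_of_le_one_left (norm_nonneg _)
      (g.opNorm_le_bound zero_le_one fun a => by simpa using hg a)
  obtain ⟨Φ, hΦ⟩ := exists_complexification φ hφ
  obtain ⟨Ψ, hΨ⟩ := exists_complexification ψ hψ
  have hpos : ∀ (χ : selfAdjoint B →ₗ[ℝ] ℝ), (∀ a : selfAdjoint B, 0 ≤ (a : B) → 0 ≤ χ a) →
      ∀ b : B, 0 ≤ b → (0 : ℂ) ≤ χ (ℜ b) + I * χ (ℑ b) := by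
    intro χ hχ b hb
    have hb' : IsSelfAdjoint b := IsSelfAdjoint.of_nonneg hb
    rw [hb'.imaginaryPart, map_zero]
    simpa using hχ (ℜ b) (by rwa [hb'.coe_realPart])
  have hone : ℜ (1 : B) = 1 := Subtype.ext (by simp)
  have hone' : ℑ (1 : B) = 0 := (IsSelfAdjoint.one B).imaginaryPart
  refine ⟨StrongDual.toWeakDual (Φ.comp A.toSubmodule.subtypeL),
    StrongDual.toWeakDual (Ψ.comp A.toSubmodule.subtypeL), φ 1, ψ 1, fun a ha => ?_,
    fun a ha => ?_, ?_, ?_, h1, fun a h k hh hk => ?_⟩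
  · change 0 ≤ Φ a
    rw [hΦ]
    exact hpos φ hφ a ha
  · change 0 ≤ Ψ a
    rw [hΨ]
    exact hpos ψ hψ a ha
  · change Φ (1 : B) = _
    simp [hΦ, hone, hone']
  · change Ψ (1 : B) = _
    simp [hΨ, hone, hone']
  · change Φ a - Ψ a = _
    rw [hΦ, hΨ, ← hG, ← hG, hh, hk, ← hf, ← hf, hfφ, hfφ]
    push_cast
    ring

/-- States determine the norm of self-adjoint elements. -/
theorem norm_le_of_forall_state_of_isSelfAdjoint {a : A.toSubmodule} (ha : IsSelfAdjoint (a : B))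
    {M : ℝ} (hM : 0 ≤ M) (h : ∀ φ ∈ A.stateSpace, ‖φ a‖ ≤ M) : ‖a‖ ≤ M := by
  rcases subsingleton_or_nontrivial B with hB | hB
  · have : a = 0 := Subtype.ext (Subsingleton.elim _ _)
    simpa [this] using hM
  obtain ⟨g, hg, hga⟩ := exists_dual_vector'' ℂ a
  obtain ⟨φ, ψ, c, d, hφ, hψ, hc, hd, hcd, hsub⟩ := exists_positive_sub_positive g
    fun b => by simpa using g.le_of_opNorm_le hg b
  have key : ∀ (χ : WeakDual ℂ A.toSubmodule) (e : ℝ),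
      (∀ a : A.toSubmodule, 0 ≤ (a : B) → 0 ≤ χ a) → χ 1 = e → ‖χ a‖ ≤ e * M := by
    intro χ e hχ he
    rcases eq_zero_or_exists_smul_state hχ he with h0 | ⟨he0, hs⟩
    · have : e = 0 := by simpa [h0] using he.symm
      simp [h0, this]
    · have := h _ hs
      have hm : ‖(e : ℂ)⁻¹ * χ a‖ ≤ M := this
      rwa [norm_mul, norm_inv, Complex.norm_real, Real.norm_of_nonneg he0.le,
        inv_mul_le_iff₀ he0] at hm
  have := hsub a a 0 ha.coe_realPart.symm (by simp [ha.imaginaryPart])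
  rw [hga] at this
  simp at this
  calc ‖a‖ = ‖φ a - ψ a‖ := by rw [this]; simp
    _ ≤ ‖φ a‖ + ‖ψ a‖ := norm_sub_le _ _
    _ ≤ c * M + d * M := add_le_add (key _ _ hφ hc) (key _ _ hψ hd)
    _ = M := by rw [← add_mul, hcd, one_mul]

/-- States are real on self-adjoint elements, so the bound passes to the real and imaginary parts of
`a`; adding these costs the factor 2. -/
theorem norm_le_of_forall_state {a : A.toSubmodule} {M : ℝ} (hM : 0 ≤ M)
    (H : ∀ φ ∈ A.stateSpace, ‖φ a‖ ≤ M) : ‖a‖ ≤ 2 * M := by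
  obtain ⟨h, hh, -⟩ := exists_coe_eq_realPart a
  obtain ⟨k, hk, -⟩ := exists_coe_eq_imaginaryPart a
  have ha : a = h + I • k := Subtype.ext (by
    simp [hh, hk, realPart_add_I_smul_imaginaryPart])
  have hh' : IsSelfAdjoint (h : B) := hh ▸ (ℜ (a : B)).2
  have hk' : IsSelfAdjoint (k : B) := hk ▸ (ℑ (a : B)).2
  have key : ∀ φ ∈ A.stateSpace, ‖φ h‖ ≤ M ∧ ‖φ k‖ ≤ M := by
    intro φ hφ
    have h1 : φ 1 = (1 : ℝ) := by simpa using hφ.1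
    obtain ⟨r, hr, -⟩ := exists_real_of_positive hφ.2 h1 hh'
    obtain ⟨s, hs, -⟩ := exists_real_of_positive hφ.2 h1 hk'
    have hφa : φ a = r + I * s := by rw [ha, map_add, map_smul, hr, hs, smul_eq_mul]
    have hre : (φ a).re = r := by simp [hφa]
    have him : (φ a).im = s := by simp [hφa]
    rw [hr, hs, Complex.norm_real, Complex.norm_real, ← hre, ← him]
    exact ⟨(Complex.abs_re_le_norm _).trans (H φ hφ), (Complex.abs_im_le_norm _).trans (H φ hφ)⟩
  have e₁ := norm_le_of_forall_state_of_isSelfAdjoint hh' hM fun φ hφ => (key φ hφ).1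
  have e₂ := norm_le_of_forall_state_of_isSelfAdjoint hk' hM fun φ hφ => (key φ hφ).2
  calc ‖a‖ ≤ ‖h‖ + ‖I • k‖ := by rw [ha]; exact norm_add_le _ _
    _ = ‖h‖ + ‖k‖ := by rw [norm_smul, Complex.norm_I, one_mul]
    _ ≤ 2 * M := by linarith

end PositiveFunctionals

end OperatorSystem

theorem Submodule.dense_of_forall_dual_eq_zero {E : Type*} [NormedAddCommGroup E]
    [NormedSpace ℂ E] (p : Submodule ℂ E)
    (h : ∀ g : StrongDual ℂ E, (∀ x ∈ p, g x = 0) → g = 0) : Dense (p : Set E) := by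
  intro x
  by_contra hx
  obtain ⟨f, u, hf, hfx⟩ := RCLike.geometric_hahn_banach_closed_point (𝕜 := ℂ)
    (s := closure (p : Set E)) ((p.restrictScalars ℝ).convex.closure) isClosed_closure hx
  have hu : 0 < u := by simpa using hf 0 (subset_closure p.zero_mem)
  have hfp : ∀ y ∈ p, f y = 0 := by
    intro y hy
    by_contra hne
    -- This multiple of `y` has value exactly `u`, against the strict bound.
    have := hf (((u : ℂ) / f y) • y) (subset_closure (p.smul_mem _ hy))
    rw [map_smul, smul_eq_mul, div_mul_cancel₀ _ hne] at this
    simp at this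
  rw [h f hfp] at hfx
  simp at hfx
  exact hfx.not_gt hu

namespace OperatorSystem

open scoped ComplexStarModule
open Complex (I)

variable {B : Type*} [CStarAlgebra B] [PartialOrder B] [StarOrderedRing B] {A : OperatorSystem B}
  {K : Set A.toSubmodule}

/-! ### Metric sets: density of the span and condition 3. -/

namespace IsMetricSet

/-- A functional which vanishes on a metric set and on the unit is zero. -/
theorem eq_zero_of_forall_eq_zero (hK : A.IsMetricSet K) (g : StrongDual ℂ A.toSubmodule)
    (hg : ∀ a ∈ K, g a = 0) (hg1 : g 1 = 0) : g = 0 := by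
  rcases subsingleton_or_nontrivial B with hB | hB
  · ext a
    rw [Subsingleton.elim a 0, map_zero, map_zero]
  wlog hgn : ∀ a, ‖g a‖ ≤ ‖a‖ generalizing g
  · have hpos : 0 < ‖g‖ + 1 := by positivity
    have := this (((‖g‖ + 1 : ℝ) : ℂ)⁻¹ • g) (fun a ha => by simp [hg a ha]) (by simp [hg1])
      fun a => by
        rw [smul_apply, smul_eq_mul, norm_mul, norm_inv, Complex.norm_real,
          Real.norm_of_nonneg hpos.le, inv_mul_le_iff₀ hpos]
        exact (g.le_opNorm a).trans (by gcongr; linarith)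
    exact (smul_eq_zero.1 this).resolve_left (inv_ne_zero (by exact_mod_cast hpos.ne'))
  have key : ∀ g' : StrongDual ℂ A.toSubmodule, (∀ a ∈ K, g' a = 0) → g' 1 = 0 → (∀ a, ‖g' a‖ ≤ ‖a‖) →
      ∀ a : A.toSubmodule, IsSelfAdjoint (a : B) → (g' a).re = 0 := by
    intro g hg hg1 hgn a ha
    obtain ⟨φ, ψ, c, d, hφ, hψ, hc, hd, hcd, hsub⟩ := exists_positive_sub_positive g hgn
    have hcd' : c = d := by
      have := hsub 1 1 0 (by simp) (by simp [(IsSelfAdjoint.one B).imaginaryPart])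
      rw [hg1, hc, hd] at this
      simp [sub_eq_zero] at this
      exact this
    have hKeq : ∀ k ∈ K, φ k = ψ k := by
      intro k hk
      obtain ⟨x, hx, hx'⟩ := exists_coe_eq_realPart k
      obtain ⟨y, hy, hy'⟩ := exists_coe_eq_imaginaryPart k
      -- Self-adjointness of `K` makes `g` vanish on the real and imaginary parts of `k`.
      have hs := hg _ (hK.star_mem k hk)
      have := hsub k x y hx hy
      rw [hx', hy'] at this
      simp [hg k hk, hs] at this
      exact sub_eq_zero.1 this
    have heq : ∀ b, φ b = ψ b := by
      rcases eq_zero_or_exists_smul_state hφ hc with h0 | ⟨hc0, hφs⟩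
      · have : c = 0 := by simpa [h0] using hc.symm
        rcases eq_zero_or_exists_smul_state hψ hd with h0' | ⟨hd0, -⟩
        · simp [h0, h0']
        · linarith
      rcases eq_zero_or_exists_smul_state hψ hd with h0' | ⟨hd0, hψs⟩
      · have : d = 0 := by simpa [h0'] using hd.symm
        linarith
      have := hK.separates _ hφs _ hψs fun k hk => by
        change (c : ℂ)⁻¹ * φ k = (d : ℂ)⁻¹ * ψ k
        rw [hKeq k hk, hcd']
      intro b
      have hb : (c : ℂ)⁻¹ * φ b = (d : ℂ)⁻¹ * ψ b := congrArg (fun χ => χ b) this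
      rw [hcd'] at hb
      exact mul_left_cancel₀ (inv_ne_zero (by exact_mod_cast hd0.ne')) hb
    have := hsub a a 0 ha.coe_realPart.symm (by simp [ha.imaginaryPart])
    rw [heq, sub_self] at this
    simp at this
    exact_mod_cast this.symm
  have hsa : ∀ a : A.toSubmodule, IsSelfAdjoint (a : B) → g a = 0 := by
    intro a ha
    refine Complex.ext (key g hg hg1 hgn a ha) ?_
    have := key (-I • g) (fun a ha => by simp [hg a ha]) (by simp [hg1])
      (fun a => by simpa using hgn a) a ha
    simpa using this
  ext a
  obtain ⟨x, hx, -⟩ := exists_coe_eq_realPart a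
  obtain ⟨y, hy, -⟩ := exists_coe_eq_imaginaryPart a
  have ha : a = x + I • y := Subtype.ext (by
    simp [hx, hy, realPart_add_I_smul_imaginaryPart])
  rw [ha, map_add, map_smul, hsa x (hx ▸ (ℜ (a : B)).2), hsa y (hy ▸ (ℑ (a : B)).2)]
  simp

theorem zero_mem (hK : A.IsMetricSet K) : 0 ∈ K :=
  hK.balanced.zero_mem hK.nonempty

theorem smul_subset_smul (hK : A.IsMetricSet K) {s t : ℝ} (hs : 0 ≤ s) (hst : s ≤ t) :
    s • K ⊆ t • K := by
  have := hK.balanced.smul_mono (a := (s : ℂ)) (b := (t : ℂ)) (by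
    rwa [Complex.norm_real, Complex.norm_real, Real.norm_of_nonneg hs,
      Real.norm_of_nonneg (hs.trans hst)])
  simpa only [← Set.image_smul, Complex.coe_smul] using this

/-- Convexity gives `s • K + t • K = (s + t) • K`, and balancedness turns a complex factor `w` into
`‖w‖`. -/
theorem exists_mem_smul_add_of_mem_span (hK : A.IsMetricSet K) {a : A.toSubmodule}
    (ha : a ∈ Submodule.span ℂ (insert 1 K)) :
    ∃ s : ℝ, 0 ≤ s ∧ ∃ k ∈ s • K, ∃ z : ℂ, a = k + z • 1 := by
  induction ha using Submodule.span_induction with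
  | mem x hx =>
    rcases hx with rfl | hx
    · exact ⟨0, le_rfl, 0, ⟨0, hK.zero_mem, by simp⟩, 1, by simp⟩
    · exact ⟨1, zero_le_one, x, by simpa using hx, 0, by simp⟩
  | zero => exact ⟨0, le_rfl, 0, ⟨0, hK.zero_mem, by simp⟩, 0, by simp⟩
  | add x y _ _ hx hy =>
    obtain ⟨s, hs, k, hk, z, rfl⟩ := hx
    obtain ⟨t, ht, l, hl, w, rfl⟩ := hy
    refine ⟨s + t, add_nonneg hs ht, k + l, ?_, z + w, by rw [add_smul]; abel⟩
    rw [hK.convex.add_smul hs ht]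
    exact Set.add_mem_add hk hl
  | smul w x _ hx =>
    obtain ⟨s, hs, _, ⟨k, hk, rfl⟩, z, rfl⟩ := hx
    have hmem : w • k ∈ ‖w‖ • K := by
      have := hK.balanced.smul_mono (a := w) (b := (‖w‖ : ℂ)) (by simp)
      have := this (Set.smul_mem_smul_set hk)
      simpa only [← Set.image_smul, Complex.coe_smul] using this
    obtain ⟨k', hk', hkk'⟩ := hmem
    refine ⟨s * ‖w‖, by positivity, s • w • k, ⟨k', hk', ?_⟩, w * z, ?_⟩
    · rw [← hkk']
      simp only [mul_smul]
    · simp only [smul_add, mul_smul]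
      rw [smul_comm w s k]

theorem dense_span (hK : A.IsMetricSet K) :
    Dense (Submodule.span ℂ (insert 1 K) : Set A.toSubmodule) :=
  Submodule.dense_of_forall_dual_eq_zero _ fun g hg =>
    hK.eq_zero_of_forall_eq_zero g
      (fun a ha => hg a (Submodule.subset_span (Set.mem_insert_of_mem _ ha)))
      (hg 1 (Submodule.subset_span (Set.mem_insert _ _)))

theorem exists_subset_of_totallyBounded (hK : A.IsMetricSet K) {S : Set A.toSubmodule}
    (hS : TotallyBounded S) {ε : ℝ} (hε : 0 < ε) :
    ∃ l : ℝ, 0 < l ∧ S ⊆ {a : A.toSubmodule | ‖a‖ ≤ ε} + l • K +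
      Set.range (fun z : ℂ => z • (1 : A.toSubmodule)) := by
  obtain ⟨t, ht, hSt⟩ := Metric.totallyBounded_iff.1 hS (ε / 2) (half_pos hε)
  have happrox : ∀ y : A.toSubmodule, ∃ s : ℝ, 0 ≤ s ∧ ∃ k ∈ s • K, ∃ z : ℂ,
      dist y (k + z • 1) < ε / 2 := by
    intro y
    obtain ⟨x, hx, hxy⟩ := Metric.mem_closure_iff.1 (hK.dense_span y) (ε / 2) (half_pos hε)
    obtain ⟨s, hs, k, hk, z, rfl⟩ := hK.exists_mem_smul_add_of_mem_span hx
    exact ⟨s, hs, k, hk, z, hxy⟩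
  choose s hs k hk z hz using happrox
  -- The sum dominates every `s y` of the net; the `1` keeps it positive.
  refine ⟨1 + ∑ y ∈ ht.toFinset, s y, by
    have := Finset.sum_nonneg fun y (_ : y ∈ ht.toFinset) => hs y
    positivity, fun a ha => ?_⟩
  obtain ⟨y, hy, hay⟩ := Set.mem_iUnion₂.1 (hSt ha)
  refine ⟨(a - (k y + z y • 1)) + k y, ⟨a - (k y + z y • 1), ?_, k y, ?_, rfl⟩, z y • 1,
    ⟨z y, rfl⟩, by simp only; abel⟩
  · rw [Set.mem_ofPred_eq, ← dist_eq_norm]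
    have := dist_triangle a y (k y + z y • 1)
    linarith [hz y, Metric.mem_ball.1 hay]
  · refine hK.smul_subset_smul (hs y) ?_ (hk y)
    have := Finset.single_le_sum (fun y _ => hs y) (ht.mem_toFinset.2 hy)
    linarith

theorem totallyBounded_of_forall_subset (hK : A.IsMetricSet K) {S : Set A.toSubmodule}
    (hS : Bornology.IsBounded S)
    (h : ∀ ε : ℝ, 0 < ε → ∃ l : ℝ, 0 < l ∧ S ⊆ {a : A.toSubmodule | ‖a‖ ≤ ε} + l • K +
      Set.range (fun z : ℂ => z • (1 : A.toSubmodule))) : TotallyBounded S := by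
  rcases subsingleton_or_nontrivial B with hB | hB
  · exact S.toFinite.totallyBounded
  obtain ⟨M, hM⟩ := hS.exists_norm_le
  obtain ⟨N, hN⟩ := hK.isCompact.isBounded.exists_norm_le
  rw [Metric.totallyBounded_iff]
  intro ε hε
  obtain ⟨l, hl, hSl⟩ := h (ε / 2) (half_pos hε)
  -- The radius bounds `z` through `z • 1 = a - e - l • k` and `‖1‖ = 1`.
  have hT : IsCompact (l • K + (fun z : ℂ => z • (1 : A.toSubmodule)) ''
      Metric.closedBall 0 (M + ε / 2 + l * N)) :=
    (hK.isCompact.smul l).add ((isCompact_closedBall _ _).image (by fun_prop))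
  obtain ⟨t, ht, htT⟩ := Metric.totallyBounded_iff.1 hT.totallyBounded (ε / 2) (half_pos hε)
  refine ⟨t, ht, fun a ha => ?_⟩
  obtain ⟨_, ⟨e, he, _, ⟨k, hk, rfl⟩, rfl⟩, _, ⟨z, rfl⟩, hsum⟩ := hSl ha
  simp only [Set.mem_ofPred_eq] at he hsum
  have hz : ‖z‖ ≤ M + ε / 2 + l * N := by
    have h1 : ‖(1 : A.toSubmodule)‖ = 1 := by rw [Submodule.coe_norm, coe_one, norm_one]
    have hzeq : z • (1 : A.toSubmodule) = a - e - l • k := by rw [← hsum]; abel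
    calc ‖z‖ = ‖z • (1 : A.toSubmodule)‖ := by rw [norm_smul, h1, mul_one]
      _ ≤ ‖a‖ + ‖e‖ + ‖l • k‖ := by
        rw [hzeq]
        exact (norm_sub_le _ _).trans (by gcongr; exact norm_sub_le _ _)
      _ ≤ M + ε / 2 + l * N := by
        rw [norm_smul, Real.norm_of_nonneg hl.le]
        gcongr
        exacts [hM a ha, hN k hk]
  obtain ⟨y, hy, hyT⟩ := Set.mem_iUnion₂.1 (htT (Set.add_mem_add (Set.smul_mem_smul_set hk)
    ⟨z, mem_closedBall_zero_iff.2 hz, rfl⟩))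
  refine Set.mem_iUnion₂.2 ⟨y, hy, ?_⟩
  rw [Metric.mem_ball] at hyT ⊢
  have hae : dist a (l • k + z • 1) ≤ ε / 2 := by
    have : a - (l • k + z • 1) = e := by
      rw [← hsum]
      abel
    rwa [dist_eq_norm, this]
  exact (dist_triangle _ _ _).trans_lt (by linarith [hyT])

end IsMetricSet

/-! ### Functions on the state space and Arzelà–Ascoli. -/

variable (A) in
/-- The embedding `a ↦ â` of an operator system into the functions on its state space. -/
noncomputable def hatLinearMap : A.toSubmodule →ₗ[ℂ] C(A.stateSpace, ℂ) where
  toFun a := ⟨A.hat a, (WeakDual.eval_continuous a).comp continuous_subtype_val⟩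
  map_add' a b := by
    ext φ
    exact map_add (φ : WeakDual ℂ A.toSubmodule) a b
  map_smul' z a := by
    ext φ
    exact map_smul (φ : WeakDual ℂ A.toSubmodule) z a

instance : CompactSpace A.stateSpace :=
  isCompact_iff_compactSpace.1 isCompact_stateSpace

theorem isUniformInducing_hatLinearMap : IsUniformInducing A.hatLinearMap := by
  have hanti : AntilipschitzWith 2 A.hatLinearMap :=
    AddMonoidHomClass.antilipschitz_of_bound _ fun a => by
      refine norm_le_of_forall_state (norm_nonneg _) fun φ hφ => ?_
      exact (A.hatLinearMap a).norm_coe_le_norm ⟨φ, hφ⟩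
  have hlip : LipschitzWith 2 A.hatLinearMap :=
    AddMonoidHomClass.lipschitz_of_bound_nnnorm _ 2 fun a => by
      rw [← NNReal.coe_le_coe]
      push_cast
      exact (ContinuousMap.norm_le _ (by positivity)).2
        fun φ => norm_apply_le_of_mem_stateSpace φ.2 a
  exact hanti.isUniformInducing hlip.uniformContinuous

theorem totallyBounded_of_equicontinuous {S : Set A.toSubmodule} {M : ℝ}
    (hM : ∀ f ∈ A.hat '' S, ∀ φ, ‖f φ‖ ≤ M) (hS : (A.hat '' S).Equicontinuous) :
    TotallyBounded S := by
  have hind : IsUniformInducing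
      (ContinuousMap.isometryEquivBoundedOfCompact A.stateSpace ℂ ∘ A.hatLinearMap) :=
    (ContinuousMap.isometryEquivBoundedOfCompact A.stateSpace ℂ).isometry.isUniformInducing.comp
      isUniformInducing_hatLinearMap
  rw [← totallyBounded_image_iff hind]
  refine (BoundedContinuousFunction.arzela_ascoli (Metric.closedBall 0 M)
    (isCompact_closedBall _ _) _ ?_ ?_).totallyBounded.subset subset_closure
  · rintro _ φ ⟨a, ha, rfl⟩
    exact mem_closedBall_zero_iff.2 (hM _ ⟨a, ha, rfl⟩ φ)
  · intro φ U hU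
    filter_upwards [hS φ U hU] with ψ hψ
    rintro ⟨_, a, ha, rfl⟩
    exact hψ ⟨_, a, ha, rfl⟩

theorem equicontinuous_of_totallyBounded {S : Set A.toSubmodule} (hS : TotallyBounded S) :
    (A.hat '' S).Equicontinuous := by
  intro φ
  rw [Metric.equicontinuousAt_iff_right]
  intro ε hε
  -- The bound `‖χ b‖ ≤ 2 * ‖b‖` for states turns `ε / 6` into `ε / 3`.
  obtain ⟨t, ht, hSt⟩ := Metric.totallyBounded_iff.1 hS (ε / 6) (by positivity)
  have hev : ∀ᶠ ψ in nhds φ, ∀ y ∈ t, dist (A.hat y φ) (A.hat y ψ) < ε / 3 := by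
    rw [ht.eventually_all]
    intro y _
    have hc : Continuous (A.hat y) := (A.hatLinearMap y).continuous
    filter_upwards [Metric.tendsto_nhds.1 (hc.tendsto φ) (ε / 3) (by positivity)] with ψ hψ
    rwa [dist_comm]
  filter_upwards [hev] with ψ hψ
  rintro ⟨_, a, ha, rfl⟩
  obtain ⟨y, hy, hay⟩ := Set.mem_iUnion₂.1 (hSt ha)
  have hb : ∀ χ : A.stateSpace, dist (A.hat a χ) (A.hat y χ) < ε / 3 := by
    intro χ
    have h1 : A.hat a χ - A.hat y χ = A.hat (a - y) χ :=
      (map_sub (χ : WeakDual ℂ A.toSubmodule) a y).symm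
    rw [dist_eq_norm, h1]
    have := norm_apply_le_of_mem_stateSpace χ.2 (a - y)
    rw [Metric.mem_ball, dist_eq_norm] at hay
    exact lt_of_le_of_lt this (by linarith)
  change dist (A.hat a φ) (A.hat a ψ) < ε
  have h1 := dist_triangle4 (A.hat a φ) (A.hat y φ) (A.hat y ψ) (A.hat a ψ)
  have h2 := hb ψ
  rw [dist_comm] at h2
  linarith [hb φ, hψ y hy]

end OperatorSystem

open OperatorSystem in
theorem corollary5p5 {B : Type*} [CStarAlgebra B] [PartialOrder B] [StarOrderedRing B]
    (A : OperatorSystem B) (K : Set A.toSubmodule) (hK : A.IsMetricSet K)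
    (S : Set A.toSubmodule) :
    List.TFAE [
      IsCompact (closure S),
      (∃ M : ℝ, ∀ f ∈ A.hat '' S, ∀ φ, ‖f φ‖ ≤ M) ∧ (A.hat '' S).Equicontinuous,
      Bornology.IsBounded S ∧ ∀ ε : ℝ, 0 < ε → ∃ l : ℝ, 0 < l ∧
        S ⊆ {a : A.toSubmodule | ‖a‖ ≤ ε} + l • K +
          Set.range (fun z : ℂ => z • (1 : A.toSubmodule))] := by
  rw [isCompact_closure_iff_totallyBounded]
  tfae_have 1 → 2 := by
    intro h
    obtain ⟨M, hM⟩ := h.isBounded.exists_norm_le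
    refine ⟨⟨2 * M, ?_⟩, equicontinuous_of_totallyBounded h⟩
    rintro _ ⟨a, ha, rfl⟩ φ
    exact (norm_apply_le_of_mem_stateSpace φ.2 a).trans (by linarith [hM a ha])
  tfae_have 2 → 1 := fun ⟨⟨_, hM⟩, h⟩ => totallyBounded_of_equicontinuous hM h
  tfae_have 1 → 3 := fun h => ⟨h.isBounded, fun _ hε => hK.exists_subset_of_totallyBounded h hε⟩
  tfae_have 3 → 1 := fun ⟨hb, h⟩ => hK.totallyBounded_of_forall_subset hb h
  tfae_finish
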